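/- Let $\mathcal H$ be a separable complex Hilbert space. **The category $\mathcal O$.** Its objects are the bounded self-adjoint operators on $\mathcal H$. There is exactly one morphism $f_{\mathcal O}:B\to A$ if $B=f(A)$ for some bounded Borel function $f:\sigma(A)\to\mathbb R$, and none otherwise. For $A\in\mathcal O$ let $W_A=\{E[A\in\Delta]\mid\Delta\subseteq\sigma(A)\text{ Borel}\}$ be the set of spectral projectors of $A$, ordered as projectors. **Coarse-graining.** For $A\in\mathcal O$, a Borel set $\Delta\subseteq\sigma(A)$ and a bounded Borel function $f:\sigma(A)\to\mathbb R$ put $$E[f(A)\in f(\Delta)]:=\inf\{Q\in W_{f(A)}\mid E[A\in\Delta]\le Q\},$$ the infimum being taken in the lattice of all projectors on $\mathcal H$; it lies in $W_{f(A)}$. The coarse-graining presheaf $\mathbf G:\mathcal O^{\rm op}\to{\rm Set}$ is given by $\mathbf G(A)=W_A$ and $\mathbf G(f_{\mathcal O})(E[A\in\Delta])=E[f(A)\in f(\Delta)]$. **The subobject classifier.** $\boldsymbol\Omega:\mathcal O^{\rm op}\to{\rm Set}$ is the presheaf for which $\boldsymbol\Omega(A)$ is the set of sieves on $A$ in $\mathcal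 O$, ordered by inclusion, with least element $0_A=\emptyset$ and greatest element ${\rm true}_A$ (all morphisms with codomain $A$), and $\boldsymbol\Omega(f_{\mathcal O})=f_{\mathcal O}^*$ is the pull-back of sieves. **Generalized valuations.** A generalized valuation $\nu$ is a family of maps $\nu_A:W_A\to\boldsymbol\Omega(A)$, $A\in\mathcal O$, such that for all $A$: 1. $\nu_{h(A)}(E[h(A)\in h(\Delta)])=h_{\mathcal O}^*(\nu_A(E[A\in\Delta]))$ for every bounded Borel $h:\sigma(A)\to\mathbb R$ and every Borel $\Delta\subseteq\sigma(A)$; 2. $\nu_A(0)=0_A$; 3. if $\alpha,\beta\in W_A$ and $\alpha\le\beta$, then $\nu_A(\alpha)\le\nu_A(\beta)$; 4. if $\alpha,\beta\in W_A$, $\alpha\beta=0$ and $\nu_A(\alpha)={\rm true}_A$, then $\nu_A(\beta)<{\rm true}_A$. **Theorem.** Let $\nu$ be a generalized valuation. Then the maps $N^\nu_A(P):=\nu_A(P)$, $P\in W_A$, are the components of a natural transformation $N^\nu:\mathbf G\to\boldsymbol\Omega$. Consequently $\nu$ corresponds to a subobject of $\mathbf G$: the sets $\mathbf K^\nu(A)=\{P\in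 W_A\mid\nu_A(P)={\rm true}_A\}$ form a subpresheaf $\mathbf K^\nu$ of $\mathbf G$, and $\mathbf K^\nu$ is the one and only subpresheaf of $\mathbf G$ whose characteristic morphism $\mathbf G\to\boldsymbol\Omega$ is $N^\nu$. -/

import Mathlib

namespace QuantumTopos

open MeasureTheory CategoryTheory Filter Topology
open scoped CompactlySupported ENNReal

/-- A bounded self-adjoint operator on the complex Hilbert space `H`. -/
@[ext]
structure SelfAdjointOp (H : Type*) [NormedAddCommGroup H] [InnerProductSpace ℂ H]
    [CompleteSpace H] where
  /-- the underlying bounded operator -/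
  toCLM : H →L[ℂ] H
  isSelfAdjoint : IsSelfAdjoint toCLM

theorem ext_of_inner {H : Type*} [NormedAddCommGroup H] [InnerProductSpace ℂ H]
    {S T : H →L[ℂ] H}
    (h : ∀ ψ, inner ℂ ψ (S ψ) = inner ℂ ψ (T ψ)) : S = T := by
  have := (ext_inner_map (S : H →ₗ[ℂ] H) (T : H →ₗ[ℂ] H)).1 fun x => by
    have := congrArg (starRingEnd ℂ) (h x)
    simpa only [inner_conj_symm] using! this
  ext x
  exact congrArg (fun L : H →ₗ[ℂ] H => L x) this

variable {H : Type*} [NormedAddCommGroup H] [InnerProductSpace ℂ H] [CompleteSpace H]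

namespace SelfAdjointOp

variable (A : SelfAdjointOp H)

/-- The spectrum `σ(A) ⊆ ℝ`. -/
abbrev spec : Set ℝ := spectrum ℝ A.toCLM

/-- The continuous functional calculus `g ↦ g(A)` on `C(σ(A), ℝ)`. -/
noncomputable abbrev contCalc : C(A.spec, ℝ) →⋆ₐ[ℝ] (H →L[ℂ] H) :=
  cfcHom (p := IsSelfAdjoint) A.isSelfAdjoint

theorem cfc_isSelfAdjoint (g : C(A.spec, ℝ)) : IsSelfAdjoint (A.contCalc g) := by
  have : IsSelfAdjoint g := by
    ext x
    simp
  exact this.map A.contCalc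

theorem inner_cfc_symm (g : C(A.spec, ℝ)) (φ ψ : H) :
    inner ℂ (A.contCalc g φ) ψ = inner ℂ φ (A.contCalc g ψ) :=
  (ContinuousLinearMap.isSelfAdjoint_iff_isSymmetric.1 (A.cfc_isSelfAdjoint g)) φ ψ

theorem inner_cfc_mul_self (g : C(A.spec, ℝ)) (ψ : H) :
    inner ℂ ψ (A.contCalc (g * g) ψ) = ((‖A.contCalc g ψ‖ ^ 2 : ℝ) : ℂ) := by
  rw [map_mul, mul_apply_eq_comp, ← inner_cfc_symm, inner_self_eq_norm_sq_to_K]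
  simp

theorem inner_cfc_self (g : C(A.spec, ℝ)) (ψ : H) :
    inner ℂ ψ (A.contCalc g ψ) = (((inner ℂ ψ (A.contCalc g ψ) : ℂ).re : ℝ) : ℂ) := by
  refine (Complex.conj_eq_iff_re.1 ?_).symm
  rw [inner_conj_symm, inner_cfc_symm]

/-- The positive functional `g ↦ ⟨ψ, g(A) ψ⟩` on the continuous functions on `σ(A)`. -/
noncomputable def functional (ψ : H) : C_c(A.spec, ℝ) →ₚ[ℝ] ℝ :=
  PositiveLinearMap.mk₀
    { toFun := fun g => (inner ℂ ψ (A.contCalc g.toContinuousMap ψ)).re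
      map_add' := fun g₁ g₂ => by
        have : (g₁ + g₂).toContinuousMap = g₁.toContinuousMap + g₂.toContinuousMap := rfl
        rw [this, map_add, add_apply, inner_add_right, Complex.add_re]
      map_smul' := fun c g => by
        have : (c • g).toContinuousMap = c • g.toContinuousMap := rfl
        rw [this, map_smul, smul_apply, ← Complex.coe_smul, inner_smul_right]
        simp }
    (fun g hg => by
      have h : g.toContinuousMap = (⟨fun x => √(g x), by fun_prop⟩ : C(A.spec, ℝ)) *
          ⟨fun x => √(g x), by fun_prop⟩ := by
        ext x
        exact (Real.mul_self_sqrt (hg x)).symm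
      change 0 ≤ (inner ℂ ψ (A.contCalc g.toContinuousMap ψ)).re
      rw [h, inner_cfc_mul_self, Complex.ofReal_re]
      positivity)

/-- The scalar spectral measure `Δ ↦ ⟨ψ, E[A ∈ Δ] ψ⟩` of `A` in the vector `ψ`: the Borel measure
on `σ(A)` that represents the functional `g ↦ ⟨ψ, g(A) ψ⟩`. -/
noncomputable def spectralMeasure (ψ : H) : Measure A.spec :=
  RealRMK.rieszMeasure (A.functional ψ)

instance (ψ : H) : IsFiniteMeasure (A.spectralMeasure ψ) := by
  unfold spectralMeasure; infer_instance

instance (ψ : H) : (A.spectralMeasure ψ).Regular := by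
  unfold spectralMeasure; infer_instance

theorem integral_spectralMeasure (g : C(A.spec, ℝ)) (ψ : H) :
    ((∫ x, g x ∂(A.spectralMeasure ψ) : ℝ) : ℂ) = inner ℂ ψ (A.contCalc g ψ) := by
  rw [inner_cfc_self]
  congr 1
  exact RealRMK.integral_rieszMeasure (A.functional ψ)
    (CompactlySupportedContinuousMap.continuousMapEquiv g)

theorem norm_cfc_sq (g : C(A.spec, ℝ)) (ψ : H) :
    ‖A.contCalc g ψ‖ ^ 2 = ∫ x, g x ^ 2 ∂(A.spectralMeasure ψ) := by
  have := A.integral_spectralMeasure (g * g) ψ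
  rw [inner_cfc_mul_self] at this
  rw [← Complex.ofReal_inj, ← this]
  congr 2
  ext x
  simp [sq]

theorem eLpNorm_two_toReal_sq {X : Type*} [MeasurableSpace X] {μ : Measure X} {f : X → ℝ}
    (hf : MemLp f 2 μ) : (eLpNorm f 2 μ).toReal ^ 2 = ∫ x, f x ^ 2 ∂μ := by
  rw [hf.eLpNorm_eq_integral_rpow_norm (by norm_num) (by norm_num), ENNReal.toReal_ofReal
    (by positivity)]
  have h0 : 0 ≤ ∫ x, f x ^ 2 ∂μ := integral_nonneg fun x => sq_nonneg _
  simp only [ENNReal.toReal_ofNat, Real.rpow_ofNat, Real.norm_eq_abs, sq_abs]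
  rw [← Real.rpow_natCast, ← Real.rpow_mul h0]
  norm_num

theorem memLp_continuous (g : C(A.spec, ℝ)) (μ : Measure A.spec) [IsFiniteMeasure μ] :
    MemLp g 2 μ := by
  refine MemLp.of_bound (C := ‖g‖) g.continuous.aestronglyMeasurable ?_
  exact ae_of_all _ fun x => g.norm_coe_le_norm x

theorem norm_cfc (g : C(A.spec, ℝ)) (ψ : H) :
    ‖A.contCalc g ψ‖ = (eLpNorm g 2 (A.spectralMeasure ψ)).toReal := by
  have h := A.norm_cfc_sq g ψ
  rw [← eLpNorm_two_toReal_sq (A.memLp_continuous g _)] at h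
  exact (pow_left_inj₀ (norm_nonneg _) ENNReal.toReal_nonneg two_ne_zero).1 h

theorem exists_approx {f : A.spec → ℝ} (μ : Measure A.spec) [IsFiniteMeasure μ]
    [μ.WeaklyRegular] (hf : MemLp f 2 μ) :
    ∃ g : ℕ → C(A.spec, ℝ), Tendsto (fun n => eLpNorm (⇑(g n) - f) 2 μ) atTop (𝓝 0) := by
  have : ∀ n : ℕ, ∃ g : C(A.spec, ℝ), eLpNorm (⇑g - f) 2 μ ≤ ((n : ℝ≥0∞) + 1)⁻¹ := by
    intro n
    obtain ⟨g, hg, -⟩ := hf.exists_boundedContinuous_eLpNorm_sub_le (by norm_num)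
      (ε := ((n : ℝ≥0∞) + 1)⁻¹) (by simp)
    exact ⟨g.toContinuousMap, by rw [eLpNorm_sub_comm]; exact hg⟩
  choose g hg using this
  refine ⟨g, tendsto_of_tendsto_of_tendsto_of_le_of_le tendsto_const_nhds ?_
    (fun _ => zero_le) hg⟩
  have := (tendsto_add_atTop_iff_nat 1).2 ENNReal.tendsto_inv_nat_nhds_zero
  simpa using this

theorem exists_vec {f : A.spec → ℝ} (ψ : H) (hf : MemLp f 2 (A.spectralMeasure ψ)) :
    ∃ v : H, ∀ g : ℕ → C(A.spec, ℝ),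
      Tendsto (fun n => eLpNorm (⇑(g n) - f) 2 (A.spectralMeasure ψ)) atTop (𝓝 0) →
      Tendsto (fun n => A.contCalc (g n) ψ) atTop (𝓝 v) := by
  set μ := A.spectralMeasure ψ
  have key : ∀ g g' : C(A.spec, ℝ), ENNReal.ofReal ‖A.contCalc g ψ - A.contCalc g' ψ‖ ≤
      eLpNorm (⇑g - f) 2 μ + eLpNorm (⇑g' - f) 2 μ := by
    intro g g'
    rw [← sub_apply, ← map_sub, norm_cfc, ENNReal.ofReal_toReal
      (A.memLp_continuous _ _).2.ne]
    have : (⇑(g - g') : A.spec → ℝ) = (⇑g - f) - (⇑g' - f) := by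
      ext x; simp
    rw [this]
    exact eLpNorm_sub_le ((A.memLp_continuous g μ).sub hf).1
      ((A.memLp_continuous g' μ).sub hf).1 (by norm_num)
  obtain ⟨g₀, hg₀⟩ := A.exists_approx μ hf
  have hc : CauchySeq (fun n => A.contCalc (g₀ n) ψ) := by
    refine EMetric.cauchySeq_iff.2 fun ε hε => ?_
    have h2 : (0 : ℝ≥0∞) < ε / 2 := ENNReal.half_pos hε.ne'
    obtain ⟨N, hN⟩ := eventually_atTop.1 (hg₀.eventually (gt_mem_nhds h2))
    refine ⟨N, fun m hm n hn => ?_⟩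
    rw [edist_dist, dist_eq_norm]
    refine (key _ _).trans_lt ?_
    calc _ < ε / 2 + ε / 2 := ENNReal.add_lt_add (hN m hm) (hN n hn)
      _ = ε := ENNReal.add_halves ε
  obtain ⟨v, hv⟩ := cauchySeq_tendsto_of_complete hc
  refine ⟨v, fun g hg => ?_⟩
  have hz : Tendsto (fun n => A.contCalc (g n) ψ - A.contCalc (g₀ n) ψ) atTop (𝓝 0) := by
    rw [tendsto_zero_iff_norm_tendsto_zero]
    have h1 : Tendsto (fun n => ENNReal.ofReal ‖A.contCalc (g n) ψ - A.contCalc (g₀ n) ψ‖) atTop (𝓝 0) :=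
      tendsto_of_tendsto_of_tendsto_of_le_of_le tendsto_const_nhds
        (by simpa using hg.add hg₀) (fun _ => zero_le) (fun n => key _ _)
    have h2 := (ENNReal.tendsto_toReal ENNReal.zero_ne_top).comp h1
    simpa [Function.comp_def, ENNReal.toReal_ofReal] using h2
  simpa using hz.add hv

theorem spectralMeasure_univ (ψ : H) : (A.spectralMeasure ψ).real Set.univ = ‖ψ‖ ^ 2 := by
  have := A.norm_cfc_sq 1 ψ
  simpa [Measure.real] using this.symm

/-- Existence of the operator `f(A)` for a bounded Borel function `f` on `σ(A)`. -/
theorem exists_borel {f : A.spec → ℝ} (hm : Measurable f) (hb : ∃ C, ∀ x, |f x| ≤ C) :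
    ∃ T : H →L[ℂ] H, (∀ ψ, inner ℂ ψ (T ψ) = ((∫ x, f x ∂(A.spectralMeasure ψ) : ℝ) : ℂ)) ∧
      ∀ ψ, ‖T ψ‖ ^ 2 = ∫ x, f x ^ 2 ∂(A.spectralMeasure ψ) := by
  obtain ⟨C, hC⟩ := hb
  have hf : ∀ (μ : Measure A.spec) [IsFiniteMeasure μ], MemLp f 2 μ := fun μ _ =>
    MemLp.of_bound (C := C) hm.aestronglyMeasurable (ae_of_all _ hC)
  choose V hV using fun ψ => A.exists_vec ψ (hf (A.spectralMeasure ψ))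
  have mono : ∀ {μ ν : Measure A.spec} {g : ℕ → C(A.spec, ℝ)}, μ ≤ ν →
      Tendsto (fun n => eLpNorm (⇑(g n) - f) 2 ν) atTop (𝓝 0) →
      Tendsto (fun n => eLpNorm (⇑(g n) - f) 2 μ) atTop (𝓝 0) := fun h hg =>
    tendsto_of_tendsto_of_tendsto_of_le_of_le tendsto_const_nhds hg (fun _ => zero_le)
      (fun n => eLpNorm_mono_measure _ h)
  have hadd : ∀ φ ψ, V (φ + ψ) = V φ + V ψ := by
    intro φ ψ
    obtain ⟨g, hg⟩ := A.exists_approx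
      (A.spectralMeasure φ + A.spectralMeasure ψ + A.spectralMeasure (φ + ψ)) (hf _)
    have h1 := hV φ g (mono (by rw [add_assoc]; exact Measure.le_add_right le_rfl) hg)
    have h2 := hV ψ g (mono (Measure.le_add_right (Measure.le_add_left le_rfl)) hg)
    have h3 := hV (φ + ψ) g (mono (Measure.le_add_left le_rfl) hg)
    refine tendsto_nhds_unique h3 ?_
    simpa using h1.add h2
  have hsmul : ∀ (c : ℂ) ψ, V (c • ψ) = c • V ψ := by
    intro c ψ
    obtain ⟨g, hg⟩ := A.exists_approx (A.spectralMeasure ψ + A.spectralMeasure (c • ψ)) (hf _)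
    have h1 := hV ψ g (mono (Measure.le_add_right le_rfl) hg)
    have h3 := hV (c • ψ) g (mono (Measure.le_add_left le_rfl) hg)
    refine tendsto_nhds_unique h3 ?_
    simpa using h1.const_smul c
  have hsq : ∀ ψ, ‖V ψ‖ ^ 2 = ∫ x, f x ^ 2 ∂(A.spectralMeasure ψ) := by
    intro ψ
    obtain ⟨g, hg⟩ := A.exists_approx (A.spectralMeasure ψ) (hf _)
    have h1 := (hV ψ g hg).norm
    have h2 : Tendsto (fun n => (eLpNorm (g n) 2 (A.spectralMeasure ψ)).toReal) atTop
        (𝓝 (eLpNorm f 2 (A.spectralMeasure ψ)).toReal) := by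
      rw [tendsto_iff_dist_tendsto_zero]
      have h3 := (ENNReal.tendsto_toReal ENNReal.zero_ne_top).comp hg
      refine squeeze_zero (fun _ => dist_nonneg) (fun n => ?_) h3
      have hgn := A.memLp_continuous (g n) (A.spectralMeasure ψ)
      have e1 := eLpNorm_add_le (p := 2) (hgn.sub (hf (A.spectralMeasure ψ))).1
        (hf (A.spectralMeasure ψ)).1 (by norm_num)
      have e2 := eLpNorm_add_le (p := 2) ((hf (A.spectralMeasure ψ)).sub hgn).1
        hgn.1 (by norm_num)
      rw [sub_add_cancel] at e1 e2
      rw [eLpNorm_sub_comm] at e2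
      have t1 := ENNReal.toReal_mono
        (ENNReal.add_ne_top.2 ⟨(hgn.sub (hf _)).2.ne, (hf _).2.ne⟩) e1
      have t2 := ENNReal.toReal_mono
        (ENNReal.add_ne_top.2 ⟨(hgn.sub (hf _)).2.ne, hgn.2.ne⟩) e2
      rw [ENNReal.toReal_add (hgn.sub (hf _)).2.ne (hf _).2.ne] at t1
      rw [ENNReal.toReal_add (hgn.sub (hf _)).2.ne hgn.2.ne] at t2
      rw [Real.dist_eq, abs_le]
      simp only [Function.comp_apply]
      constructor <;> linarith
    simp_rw [norm_cfc] at h1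
    rw [tendsto_nhds_unique h1 h2, eLpNorm_two_toReal_sq (hf _)]
  have hbound : ∀ ψ, ‖V ψ‖ ≤ |C| * ‖ψ‖ := by
    intro ψ
    refine (pow_le_pow_iff_left₀ (norm_nonneg _) (by positivity) two_ne_zero).1 ?_
    rw [hsq, mul_pow, ← A.spectralMeasure_univ ψ]
    calc _ ≤ ∫ x, |C| ^ 2 ∂(A.spectralMeasure ψ) := by
          refine integral_mono_of_nonneg (ae_of_all _ fun x => sq_nonneg _)
            (integrable_const _) (ae_of_all _ fun x => ?_)
          exact sq_le_sq.2 (by rw [abs_abs]; exact (hC x).trans (le_abs_self C))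
      _ = _ := by simp [mul_comm]
  refine ⟨LinearMap.mkContinuous ⟨⟨V, hadd⟩, hsmul⟩ |C| hbound, fun ψ => ?_, hsq⟩
  change inner ℂ ψ (V ψ) = _
  obtain ⟨g, hg⟩ := A.exists_approx (A.spectralMeasure ψ) (hf _)
  have h1 : Tendsto (fun n => inner ℂ ψ (A.contCalc (g n) ψ)) atTop (𝓝 (inner ℂ ψ (V ψ))) :=
    tendsto_const_nhds.inner (hV ψ g hg)
  refine tendsto_nhds_unique h1 ?_
  simp_rw [← integral_spectralMeasure]
  refine (Complex.continuous_ofReal.tendsto _).comp ?_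
  refine tendsto_integral_of_L1' f hm.aestronglyMeasurable
    (Eventually.of_forall fun n => (A.memLp_continuous (g n) _).integrable (by norm_num)) ?_
  set K := (A.spectralMeasure ψ) Set.univ ^ (1 / (1 : ℝ≥0∞).toReal - 1 / (2 : ℝ≥0∞).toReal)
  have hK : K ≠ ∞ := ENNReal.rpow_ne_top_of_nonneg (by norm_num) (measure_ne_top _ _)
  have h4 : Tendsto (fun n => eLpNorm (⇑(g n) - f) 2 (A.spectralMeasure ψ) * K) atTop (𝓝 0) := by
    simpa using ENNReal.Tendsto.mul_const hg (Or.inr hK)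
  exact tendsto_of_tendsto_of_tendsto_of_le_of_le tendsto_const_nhds h4 (fun _ => zero_le)
    (fun n => eLpNorm_le_eLpNorm_mul_rpow_measure_univ (by norm_num)
      ((A.memLp_continuous (g n) _).sub (hf _)).1)

/-- `T` represents `f(A) = ∫ f(λ) dE_λ`: `⟨ψ, T ψ⟩ = ∫ f(λ) d⟨ψ, E_λ ψ⟩` for all `ψ`. -/
def IsBorelCalc (f : A.spec → ℝ) (T : H →L[ℂ] H) : Prop :=
  ∀ ψ, inner ℂ ψ (T ψ) = ((∫ x, f x ∂(A.spectralMeasure ψ) : ℝ) : ℂ)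

/-- A bounded Borel function `σ(A) → ℝ`. -/
structure BorelFn where
  /-- the underlying function -/
  toFun : A.spec → ℝ
  measurable : Measurable toFun
  bounded : ∃ C, ∀ x, |toFun x| ≤ C

variable {A}

theorem IsBorelCalc.unique {f : A.spec → ℝ} {S T : H →L[ℂ] H} (hS : A.IsBorelCalc f S)
    (hT : A.IsBorelCalc f T) : S = T :=
  ext_of_inner fun ψ => (hS ψ).trans (hT ψ).symm

theorem IsBorelCalc.isSelfAdjoint {f : A.spec → ℝ} {T : H →L[ℂ] H} (hT : A.IsBorelCalc f T) :
    IsSelfAdjoint T := by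
  rw [ContinuousLinearMap.isSelfAdjoint_iff_isSymmetric, LinearMap.isSymmetric_iff_inner_map_self_real]
  intro ψ
  have h := hT ψ
  change inner ℂ ψ ((T : H →ₗ[ℂ] H) ψ) = _ at h
  rw [inner_conj_symm, h, ← inner_conj_symm, h, Complex.conj_ofReal]

namespace BorelFn

theorem exists_op (f : A.BorelFn) : ∃ T : H →L[ℂ] H, A.IsBorelCalc f.toFun T :=
  (A.exists_borel f.measurable f.bounded).imp fun _ h => h.1

/-- The operator `f(A)`. -/
noncomputable def toOp (f : A.BorelFn) : SelfAdjointOp H where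
  toCLM := f.exists_op.choose
  isSelfAdjoint := f.exists_op.choose_spec.isSelfAdjoint

theorem toOp_spec (f : A.BorelFn) : A.IsBorelCalc f.toFun f.toOp.toCLM := f.exists_op.choose_spec

theorem norm_sq (f : A.BorelFn) (ψ : H) :
    ‖f.toOp.toCLM ψ‖ ^ 2 = ∫ x, f.toFun x ^ 2 ∂(A.spectralMeasure ψ) := by
  obtain ⟨T, hT, hT'⟩ := A.exists_borel f.measurable f.bounded
  rw [f.toOp_spec.unique hT, hT']

theorem integrable (f : A.BorelFn) (ψ : H) : Integrable f.toFun (A.spectralMeasure ψ) := by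
  obtain ⟨C, hC⟩ := f.bounded
  exact Integrable.of_bound f.measurable.aestronglyMeasurable C (ae_of_all _ hC)

/-- Pointwise product. -/
def mul (f g : A.BorelFn) : A.BorelFn where
  toFun x := f.toFun x * g.toFun x
  measurable := f.measurable.mul g.measurable
  bounded := by
    obtain ⟨C, hC⟩ := f.bounded
    obtain ⟨D, hD⟩ := g.bounded
    refine ⟨C * D, fun x => ?_⟩
    rw [abs_mul]
    exact mul_le_mul (hC x) (hD x) (abs_nonneg _) ((abs_nonneg _).trans (hC x))

/-- Pointwise sum. -/
def add (f g : A.BorelFn) : A.BorelFn where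
  toFun x := f.toFun x + g.toFun x
  measurable := f.measurable.add g.measurable
  bounded := by
    obtain ⟨C, hC⟩ := f.bounded
    obtain ⟨D, hD⟩ := g.bounded
    exact ⟨C + D, fun x => (abs_add_le _ _).trans (add_le_add (hC x) (hD x))⟩

/-- Constant function. -/
def const (A : SelfAdjointOp H) (c : ℝ) : A.BorelFn := ⟨fun _ => c, measurable_const, |c|, fun _ => le_rfl⟩

theorem toOp_add (f g : A.BorelFn) : (f.add g).toOp.toCLM = f.toOp.toCLM + g.toOp.toCLM := by
  refine (f.add g).toOp_spec.unique fun ψ => ?_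
  rw [add_apply, inner_add_right, f.toOp_spec, g.toOp_spec, ← Complex.ofReal_add,
    ← integral_add (f.integrable ψ) (g.integrable ψ)]
  rfl

theorem toOp_const (A : SelfAdjointOp H) (c : ℝ) : (const A c).toOp.toCLM = (c : ℂ) • (1 : H →L[ℂ] H) := by
  refine (const A c).toOp_spec.unique fun ψ => ?_
  have : (const A c).toFun = fun _ => c := rfl
  rw [this, integral_const, A.spectralMeasure_univ, smul_apply,
    inner_smul_right, one_apply_eq_self, inner_self_eq_norm_sq_to_K]
  simp [mul_comm]

theorem toOp_mul_self (f : A.BorelFn) : (f.mul f).toOp.toCLM = f.toOp.toCLM * f.toOp.toCLM := by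
  refine (f.mul f).toOp_spec.unique fun ψ => ?_
  have hs := ContinuousLinearMap.isSelfAdjoint_iff_isSymmetric.1 f.toOp.isSelfAdjoint
  have h1 : inner ℂ ψ ((f.toOp.toCLM * f.toOp.toCLM) ψ) = inner ℂ (f.toOp.toCLM ψ) (f.toOp.toCLM ψ) :=
    (hs ψ (f.toOp.toCLM ψ)).symm
  have h2 : (f.mul f).toFun = fun x => f.toFun x ^ 2 := funext fun x => (sq _).symm
  rw [h1, inner_self_eq_norm_sq_to_K, h2, ← f.norm_sq ψ]
  simp

theorem toOp_congr {f g : A.BorelFn} (h : ∀ x, f.toFun x = g.toFun x) : f.toOp = g.toOp := by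
  have : f.toFun = g.toFun := funext h
  ext1
  refine f.toOp_spec.unique ?_
  rw [this]
  exact g.toOp_spec

theorem toOp_mul_of_commute (f g : A.BorelFn) (hc : Commute f.toOp.toCLM g.toOp.toCLM) :
    (f.mul g).toOp.toCLM = f.toOp.toCLM * g.toOp.toCLM := by
  have h := (f.add g).toOp_mul_self
  rw [toOp_add] at h
  have h' : ((f.add g).mul (f.add g)).toOp =
      (((f.mul f).add (g.mul g)).add ((f.mul g).add (f.mul g))).toOp :=
    toOp_congr fun x => by simp only [mul, add]; ring
  rw [h', toOp_add, toOp_add, toOp_add, toOp_mul_self, toOp_mul_self, mul_add, add_mul, add_mul,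
    ← hc.eq] at h
  have h2 : (2 : ℂ) • (f.mul g).toOp.toCLM = (2 : ℂ) • (f.toOp.toCLM * g.toOp.toCLM) := by
    rw [two_smul, two_smul]
    have := congrArg (fun T => T - f.toOp.toCLM * f.toOp.toCLM - g.toOp.toCLM * g.toOp.toCLM) h
    convert this using 1 <;> abel
  exact smul_right_injective _ (two_ne_zero) h2

theorem toOp_polynomial (f : A.BorelFn) (p : Polynomial ℝ) :
    ∃ g : A.BorelFn, (∀ x, g.toFun x = p.eval (f.toFun x)) ∧
      g.toOp.toCLM = Polynomial.aeval f.toOp.toCLM p := by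
  have hpow : ∀ n : ℕ, ∃ g : A.BorelFn, (∀ x, g.toFun x = f.toFun x ^ n) ∧
      g.toOp.toCLM = f.toOp.toCLM ^ n := by
    intro n
    induction n with
    | zero => exact ⟨const A 1, fun x => by simp [const], by rw [toOp_const]; simp⟩
    | succ n ih =>
      obtain ⟨g, hg, hg'⟩ := ih
      refine ⟨f.mul g, fun x => by simp [mul, hg, pow_succ, mul_comm], ?_⟩
      rw [toOp_mul_of_commute, hg', pow_succ']
      rw [hg']
      exact Commute.self_pow _ _
  induction p using Polynomial.induction_on' with
  | add p q hp hq =>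
    obtain ⟨g, hg, hg'⟩ := hp
    obtain ⟨k, hk, hk'⟩ := hq
    exact ⟨g.add k, fun x => by simp [add, hg, hk], by rw [toOp_add, hg', hk', map_add]⟩
  | monomial n a =>
    obtain ⟨g, hg, hg'⟩ := hpow n
    refine ⟨(const A a).mul g, fun x => by simp [mul, const, hg], ?_⟩
    rw [toOp_mul_of_commute, hg', toOp_const, Polynomial.aeval_monomial,
      Algebra.algebraMap_eq_smul_one, Complex.coe_smul]
    rw [toOp_const]
    exact (Commute.one_left _).smul_left _

/-- The spectral measures of `f(A)` are the images under `f` of those of `A`. -/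
theorem map_spectralMeasure (f : A.BorelFn) (ψ : H) :
    (f.toOp.spectralMeasure ψ).map Subtype.val = (A.spectralMeasure ψ).map f.toFun := by
  set B := f.toOp with hB
  have hv : Measurable (Subtype.val : B.spec → ℝ) := measurable_subtype_coe
  have hpoly : ∀ p : Polynomial ℝ, ∫ x, p.eval (x : ℝ) ∂(B.spectralMeasure ψ) =
      ∫ x, p.eval (f.toFun x) ∂(A.spectralMeasure ψ) := by
    intro p
    obtain ⟨g, hg, hg'⟩ := f.toOp_polynomial p
    have h1 := g.toOp_spec ψ
    simp_rw [hg] at h1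
    rw [← Complex.ofReal_inj, ← h1, hg', ← cfc_polynomial p f.toOp.toCLM f.toOp.isSelfAdjoint,
      cfc_apply (fun x => p.eval x) f.toOp.toCLM f.toOp.isSelfAdjoint (by fun_prop)]
    exact B.integral_spectralMeasure ⟨fun x => p.eval (x : ℝ), by fun_prop⟩ ψ
  obtain ⟨C, hC⟩ := f.bounded
  obtain ⟨D, hD⟩ : ∃ D : ℝ, ∀ x : B.spec, |(x : ℝ)| ≤ D :=
    ⟨‖B.toCLM‖ * ‖(1 : H →L[ℂ] H)‖, fun x => spectrum.norm_le_norm_mul_of_mem x.2⟩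
  set R := max C D
  refine ext_of_forall_integral_eq_of_IsFiniteMeasure fun k => ?_
  rw [integral_map hv.aemeasurable k.continuous.aestronglyMeasurable,
    integral_map f.measurable.aemeasurable k.continuous.aestronglyMeasurable]
  refine eq_of_forall_dist_le fun ε hε => ?_
  set M := (A.spectralMeasure ψ).real Set.univ + (B.spectralMeasure ψ).real Set.univ + 1
  have hM : 0 < M := by positivity
  obtain ⟨p, hp⟩ := exists_polynomial_near_of_continuousOn (-R) R k k.continuous.continuousOn
    (ε / M) (by positivity)
  have hI : ∀ {X : Type _} [MeasurableSpace X] (μ : Measure X) [IsFiniteMeasure μ] (u : X → ℝ),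
      Measurable u → (∀ x, |u x| ≤ R) →
      |∫ x, k (u x) ∂μ - ∫ x, p.eval (u x) ∂μ| ≤ ε / M * μ.real Set.univ := by
    intro X _ μ _ u hu hR
    have i1 : Integrable (fun x => k (u x)) μ :=
      Integrable.of_bound (k.continuous.measurable.comp hu).aestronglyMeasurable ‖k‖
        (ae_of_all _ fun x => k.norm_coe_le_norm _)
    have hle : ∀ x, ‖k (u x) - p.eval (u x)‖ ≤ ε / M := fun x => by
      rw [Real.norm_eq_abs, abs_sub_comm]
      exact (hp (u x) (abs_le.1 (hR x))).le
    have i2 : Integrable (fun x => k (u x) - p.eval (u x)) μ :=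
      Integrable.of_bound ((k.continuous.measurable.comp hu).sub
        (p.continuous.measurable.comp hu)).aestronglyMeasurable _ (ae_of_all _ hle)
    have i3 : Integrable (fun x => p.eval (u x)) μ := by
      refine (i1.sub i2).congr (ae_of_all _ fun x => ?_)
      simp
    rw [← integral_sub i1 i3]
    exact norm_integral_le_of_norm_le_const (ae_of_all _ hle)
  have e1 := hI (B.spectralMeasure ψ) Subtype.val hv fun x => (hD x).trans (le_max_right _ _)
  have e2 := hI (A.spectralMeasure ψ) f.toFun f.measurable fun x => (hC x).trans (le_max_left _ _)
  rw [hpoly] at e1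
  have hsum : ε / M * (B.spectralMeasure ψ).real Set.univ +
      ε / M * (A.spectralMeasure ψ).real Set.univ ≤ ε := by
    rw [← mul_add, div_mul_eq_mul_div, div_le_iff₀ hM]
    exact mul_le_mul_of_nonneg_left (by simp only [M]; linarith) hε.le
  rw [Real.dist_eq]
  rw [abs_le] at e1 e2 ⊢
  constructor <;> linarith [e1.1, e1.2, e2.1, e2.2]

end BorelFn

/-- The identity function on the spectrum. -/
def BorelFn.id (A : SelfAdjointOp H) : A.BorelFn where
  toFun := Subtype.val
  measurable := measurable_subtype_coe
  bounded := ⟨‖A.toCLM‖ * ‖(1 : H →L[ℂ] H)‖, fun x => spectrum.norm_le_norm_mul_of_mem x.2⟩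

theorem BorelFn.toOp_id (A : SelfAdjointOp H) : (BorelFn.id A).toOp = A := by
  ext1
  refine (BorelFn.id A).toOp_spec.unique fun ψ => ?_
  have h := A.integral_spectralMeasure (ContinuousMap.restrict A.spec (ContinuousMap.id ℝ)) ψ
  rw [contCalc, cfcHom_id] at h
  exact h.symm

theorem BorelFn.integral_toOp (f : A.BorelFn) {g : ℝ → ℝ} (hg : Measurable g) (ψ : H) :
    ∫ x, g x ∂(f.toOp.spectralMeasure ψ) = ∫ x, g (f.toFun x) ∂(A.spectralMeasure ψ) := by
  rw [← integral_map f.measurable.aemeasurable hg.aestronglyMeasurable, ← f.map_spectralMeasure,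
    integral_map measurable_subtype_coe.aemeasurable hg.aestronglyMeasurable]

/-- The composite `g ∘ f` of Borel functions `f` on `σ(A)` and `g` on `σ(f(A))`. As `f` may leave
`σ(f(A))` on a null set, `g` is extended by zero to the real line. -/
noncomputable def BorelFn.comp (f : A.BorelFn) (g : f.toOp.BorelFn) : A.BorelFn where
  toFun x := Function.extend Subtype.val g.toFun 0 (f.toFun x)
  measurable := ((MeasurableEmbedding.subtype_coe
    (spectrum.isClosed (𝕜 := ℝ) f.toOp.toCLM).measurableSet).measurable_extend
      g.measurable measurable_zero).comp f.measurable
  bounded := by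
    obtain ⟨C, hC⟩ := g.bounded
    refine ⟨|C|, fun x => ?_⟩
    by_cases h : ∃ y : f.toOp.spec, (y : ℝ) = f.toFun x
    · obtain ⟨y, hy⟩ := h
      rw [← hy, Subtype.val_injective.extend_apply]
      exact (hC y).trans (le_abs_self C)
    · rw [Function.extend_apply' _ _ _ h]
      simp

theorem BorelFn.toOp_comp (f : A.BorelFn) (g : f.toOp.BorelFn) : (f.comp g).toOp = g.toOp := by
  ext1
  refine (f.comp g).toOp_spec.unique fun ψ => ?_
  rw [g.toOp_spec, Complex.ofReal_inj]
  have h := f.integral_toOp ((MeasurableEmbedding.subtype_coe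
    (spectrum.isClosed (𝕜 := ℝ) f.toOp.toCLM).measurableSet).measurable_extend
      g.measurable measurable_zero) ψ
  simp_rw [Subtype.val_injective.extend_apply] at h
  exact h

/-- `B ≤ A` if `B = f(A)` for some bounded Borel function `f` on `σ(A)`. The category of this
preorder, with one morphism `f_𝒪 : B ⟶ A` for each related pair, is the category `𝒪`. -/
instance : Preorder (SelfAdjointOp H) where
  le B A := ∃ f : A.BorelFn, B = f.toOp
  le_refl A := ⟨BorelFn.id A, (BorelFn.toOp_id A).symm⟩
  le_trans := by
    rintro C B A ⟨g, rfl⟩ ⟨f, rfl⟩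
    exact ⟨f.comp g, (f.toOp_comp g).symm⟩

/-- The morphism `f_𝒪 : f(A) ⟶ A`. -/
noncomputable def BorelFn.hom (f : A.BorelFn) : f.toOp ⟶ A := homOfLE ⟨f, rfl⟩

end SelfAdjointOp

/-- The projection operators on `H`, ordered by the usual order of operators. -/
abbrev Projector (H : Type*) [NormedAddCommGroup H] [InnerProductSpace ℂ H] [CompleteSpace H] :=
  {P : H →L[ℂ] H // IsStarProjection P}

namespace SelfAdjointOp

variable (A : SelfAdjointOp H)

/-- The characteristic function of a Borel subset of `σ(A)`. -/
noncomputable def charFn (Δ : Set A.spec) (hΔ : MeasurableSet Δ) : A.BorelFn where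
  toFun := Δ.indicator 1
  measurable := measurable_one.indicator hΔ
  bounded := ⟨1, fun x => by by_cases h : x ∈ Δ <;> simp [h]⟩

/-- The spectral projector `E[A ∈ Δ] = χ_Δ(A)`. -/
noncomputable def specProj (Δ : Set A.spec) (hΔ : MeasurableSet Δ) : Projector H :=
  ⟨(A.charFn Δ hΔ).toOp.toCLM, by
    refine ⟨?_, (A.charFn Δ hΔ).toOp.isSelfAdjoint⟩
    rw [IsIdempotentElem, ← BorelFn.toOp_mul_self]
    congr 1
    refine BorelFn.toOp_congr fun x => ?_
    by_cases h : x ∈ Δ <;> simp [BorelFn.mul, charFn, h]⟩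

/-- The spectral algebra `W_A` of all spectral projectors of `A`. -/
def W : Set (Projector H) := {P | ∃ (Δ : Set A.spec) (hΔ : MeasurableSet Δ), P = A.specProj Δ hΔ}

theorem inner_specProj (Δ : Set A.spec) (hΔ : MeasurableSet Δ) (ψ : H) :
    inner ℂ ψ ((A.specProj Δ hΔ).1 ψ) = (((A.spectralMeasure ψ).real Δ : ℝ) : ℂ) := by
  have h := (A.charFn Δ hΔ).toOp_spec ψ
  rw [show (A.charFn Δ hΔ).toFun = Δ.indicator 1 from rfl, integral_indicator_one hΔ] at h
  exact h

theorem norm_specProj_sq (Δ : Set A.spec) (hΔ : MeasurableSet Δ) (ψ : H) :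
    ‖(A.specProj Δ hΔ).1 ψ‖ ^ 2 = (A.spectralMeasure ψ).real Δ := by
  have h := (A.charFn Δ hΔ).norm_sq ψ
  rw [← integral_indicator_one hΔ]
  refine h.trans (integral_congr_ae (ae_of_all _ fun x => ?_))
  by_cases hx : x ∈ Δ <;> simp [charFn, hx]

theorem specProj_compl (Δ : Set A.spec) (hΔ : MeasurableSet Δ) :
    (A.specProj Δᶜ hΔ.compl).1 = 1 - (A.specProj Δ hΔ).1 := by
  refine ext_of_inner fun ψ => ?_
  rw [sub_apply, inner_sub_right, inner_specProj, inner_specProj, one_apply_eq_self,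
    measureReal_compl hΔ, A.spectralMeasure_univ, inner_self_eq_norm_sq_to_K]
  simp

theorem specProj_le {Δ₁ Δ₂ : Set A.spec} (h₁ : MeasurableSet Δ₁) (h₂ : MeasurableSet Δ₂)
    (h : ∀ ψ, A.spectralMeasure ψ Δ₁ ≤ A.spectralMeasure ψ Δ₂) :
    A.specProj Δ₁ h₁ ≤ A.specProj Δ₂ h₂ := by
  change (A.specProj Δ₁ h₁).1 ≤ (A.specProj Δ₂ h₂).1
  rw [ContinuousLinearMap.le_def, ContinuousLinearMap.isPositive_iff_complex]
  intro ψ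
  have hh : inner ℂ (((A.specProj Δ₂ h₂).1 - (A.specProj Δ₁ h₁).1) ψ) ψ =
      (((A.spectralMeasure ψ).real Δ₂ - (A.spectralMeasure ψ).real Δ₁ : ℝ) : ℂ) := by
    rw [← inner_conj_symm, sub_apply, inner_sub_right, inner_specProj, inner_specProj]
    simp
  rw [hh]
  refine ⟨by simp, ?_⟩
  have := ENNReal.toReal_mono (measure_ne_top _ _) (h ψ)
  simpa [Measure.real] using this

theorem le_specProj_iff (P : Projector H) (Δ : Set A.spec) (hΔ : MeasurableSet Δ) :
    P ≤ A.specProj Δ hΔ ↔ ∀ ψ, A.spectralMeasure (P.1 ψ) Δᶜ = 0 := by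
  change P.1 ≤ (A.specProj Δ hΔ).1 ↔ _
  rw [P.2.le_iff_mul_eq_right (A.specProj Δ hΔ).2]
  have key : ∀ ψ, A.spectralMeasure (P.1 ψ) Δᶜ = 0 ↔
      (A.specProj Δ hΔ).1 (P.1 ψ) = P.1 ψ := by
    intro ψ
    have h := A.norm_specProj_sq Δᶜ hΔ.compl (P.1 ψ)
    rw [specProj_compl] at h
    rw [← measureReal_eq_zero_iff, ← h, sq_eq_zero_iff, norm_eq_zero, sub_apply, sub_eq_zero,
      one_apply_eq_self, eq_comm]
  simp_rw [key]
  exact ⟨fun h ψ => congrArg (fun T : H →L[ℂ] H => T ψ) h, fun h => ContinuousLinearMap.ext h⟩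

theorem W_mono {A B : SelfAdjointOp H} (h : B ≤ A) : B.W ⊆ A.W := by
  obtain ⟨f, rfl⟩ := h
  rintro _ ⟨K, hK, rfl⟩
  have hK' : MeasurableSet (Subtype.val '' K) :=
    (spectrum.isClosed (𝕜 := ℝ) f.toOp.toCLM).measurableSet.subtype_image hK
  refine ⟨f.toFun ⁻¹' (Subtype.val '' K), f.measurable hK', Subtype.ext ?_⟩
  refine ext_of_inner fun ψ => ?_
  rw [inner_specProj, inner_specProj]
  congr 1
  rw [Measure.real, Measure.real, ← Measure.map_apply f.measurable hK', ← f.map_spectralMeasure,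
    Measure.map_apply measurable_subtype_coe hK', Set.preimage_image_eq _ Subtype.val_injective]

section Separable

variable [TopologicalSpace.SeparableSpace H]

/-- On a separable Hilbert space the spectral algebra is closed under the infima that define the
coarse-graining operation. -/
theorem exists_isGLB (B : SelfAdjointOp H) (P : Projector H) :
    ∃ Q : B.W, IsGLB {R : Projector H | R ∈ B.W ∧ P ≤ R} Q := by
  let d := TopologicalSpace.denseSeq H
  obtain ⟨ν, hν, hac, -⟩ := exists_isFiniteMeasure_absolutelyContinuous
    (Measure.sum fun n => B.spectralMeasure (d n))
  let S : Set (Set B.spec) := {Δ | MeasurableSet Δ ∧ ∀ ψ, B.spectralMeasure (P.1 ψ) Δᶜ = 0}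
  have hne : (ν '' S).Nonempty := ⟨_, Set.univ, ⟨MeasurableSet.univ, by simp⟩, rfl⟩
  obtain ⟨u, -, hu, huS⟩ := exists_seq_tendsto_sInf hne (OrderBot.bddBelow _)
  choose D hD hDu using huS
  let E := ⋂ n, D n
  have hES : E ∈ S := by
    refine ⟨MeasurableSet.iInter fun n => (hD n).1, fun ψ => ?_⟩
    rw [Set.compl_iInter]
    exact measure_iUnion_null fun n => (hD n).2 ψ
  have hEle : ν E ≤ sInf (ν '' S) :=
    ge_of_tendsto' hu fun n => (measure_mono (Set.iInter_subset D n)).trans_eq (hDu n)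
  refine ⟨⟨B.specProj E hES.1, E, hES.1, rfl⟩, IsLeast.isGLB ⟨⟨⟨E, hES.1, rfl⟩, ?_⟩, ?_⟩⟩
  · exact (B.le_specProj_iff P E hES.1).2 hES.2
  rintro _ ⟨⟨F, hF, rfl⟩, hPF⟩
  rw [le_specProj_iff] at hPF
  have hEF : E ∩ F ∈ S := by
    refine ⟨hES.1.inter hF, fun ψ => ?_⟩
    rw [Set.compl_inter]
    exact measure_union_null (hES.2 ψ) (hPF ψ)
  have h0 : ν (E \ F) = 0 := by
    have h1 := measure_inter_add_sdiff (μ := ν) E hF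
    have h2 : ν E ≤ ν (E ∩ F) := hEle.trans (sInf_le ⟨_, hEF, rfl⟩)
    rw [← h1] at h2
    by_contra hc
    exact absurd h2 (not_le.2 (ENNReal.lt_add_right (measure_ne_top _ _) hc))
  have h1 := hac h0
  rw [Measure.sum_apply _ (hES.1.diff hF), ENNReal.tsum_eq_zero] at h1
  have h2 : (B.specProj (E \ F) (hES.1.diff hF)).1 = 0 := by
    refine ContinuousLinearMap.coeFn_injective ?_
    refine Continuous.ext_on (TopologicalSpace.denseRange_denseSeq H)
      (ContinuousLinearMap.continuous _) (ContinuousLinearMap.continuous _) ?_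
    rintro _ ⟨n, rfl⟩
    have := B.norm_specProj_sq (E \ F) (hES.1.diff hF) (d n)
    rw [Measure.real, h1 n] at this
    simpa using this
  refine B.specProj_le hES.1 hF fun ψ => ?_
  have h3 := B.norm_specProj_sq (E \ F) (hES.1.diff hF) ψ
  rw [h2] at h3
  have h4 : B.spectralMeasure ψ (E \ F) = 0 := by
    rw [← measureReal_eq_zero_iff, ← h3]
    simp
  calc B.spectralMeasure ψ E = B.spectralMeasure ψ (E ∩ F) + B.spectralMeasure ψ (E \ F) :=
        (measure_inter_add_sdiff E hF).symm
    _ ≤ B.spectralMeasure ψ F := by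
        rw [h4, add_zero]
        exact measure_mono Set.inter_subset_right

/-- Coarse-graining of a projector `P` to the context `B`: the infimum, in the lattice of all
projectors, of the `Q ∈ W_B` with `P ≤ Q`. For `P = E[A ∈ Δ]` and `B = f(A)` this is
`E[f(A) ∈ f(Δ)] := inf {E[f(A) ∈ K] | E[A ∈ Δ] ≤ E[f(A) ∈ K]}`. -/
noncomputable def coarseGrain (B : SelfAdjointOp H) (P : Projector H) : B.W :=
  (B.exists_isGLB P).choose

theorem coarseGrain_isGLB (B : SelfAdjointOp H) (P : Projector H) :
    IsGLB {Q : Projector H | Q ∈ B.W ∧ P ≤ Q} (B.coarseGrain P : Projector H) :=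
  (B.exists_isGLB P).choose_spec

theorem coarseGrain_self (P : A.W) : A.coarseGrain P = P := by
  refine Subtype.ext ((A.coarseGrain_isGLB P).unique ?_)
  exact IsLeast.isGLB ⟨⟨P.2, le_rfl⟩, fun Q hQ => hQ.2⟩

theorem coarseGrain_coarseGrain {B C : SelfAdjointOp H} (h : C ≤ B) (P : Projector H) :
    C.coarseGrain (B.coarseGrain P) = C.coarseGrain P := by
  refine Subtype.ext ((C.coarseGrain_isGLB _).unique ?_)
  have : {Q : Projector H | Q ∈ C.W ∧ (B.coarseGrain P : Projector H) ≤ Q} =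
      {Q | Q ∈ C.W ∧ P ≤ Q} := by
    ext Q
    refine and_congr_right fun hQ => ⟨fun hle => ?_, fun hle => ?_⟩
    · exact ((B.coarseGrain_isGLB P).2 fun R hR => hR.2).trans hle
    · exact (B.coarseGrain_isGLB P).1 ⟨W_mono h hQ, hle⟩
  rw [this]
  exact C.coarseGrain_isGLB P

end Separable

end SelfAdjointOp

open SelfAdjointOp

section Valuations

universe u

variable (H : Type u) [NormedAddCommGroup H] [InnerProductSpace ℂ H] [CompleteSpace H]
  [TopologicalSpace.SeparableSpace H]

/-- The coarse-graining presheaf `G` on `𝒪`: `G(A) = W_A`, and for `B = f(A)` the map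
`G(f_𝒪) : W_A → W_B` is `E[A ∈ Δ] ↦ E[f(A) ∈ f(Δ)]`. -/
noncomputable def coarseGrainingPresheaf : (SelfAdjointOp H)ᵒᵖ ⥤ Type u where
  obj A := A.unop.W
  map {_ B} _ := ↾fun P => B.unop.coarseGrain P
  map_id A := by
    ext P : 3
    exact A.unop.coarseGrain_self P
  map_comp {_ B C} _ g := by
    ext P : 3
    exact (coarseGrain_coarseGrain (leOfHom g.unop) _).symm

/-- A generalized valuation: maps `ν_A : W_A → Ω(A)` to the sieves on `A` in `𝒪`. -/
structure GeneralizedValuation where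
  /-- the maps `ν_A` -/
  val (A : SelfAdjointOp H) : A.W → Sieve A
  /-- `ν_{h(A)}(E[h(A) ∈ h(Δ)]) = h_𝒪^*(ν_A(E[A ∈ Δ]))` -/
  functional_composition (A : SelfAdjointOp H) (h : A.BorelFn) (P : A.W) :
    val h.toOp (h.toOp.coarseGrain P) = (val A P).pullback h.hom
  null (A : SelfAdjointOp H) (P : A.W) : P.1.1 = 0 → val A P = ⊥
  monotone (A : SelfAdjointOp H) (P Q : A.W) : P.1 ≤ Q.1 → val A P ≤ val A Q
  exclusive (A : SelfAdjointOp H) (P Q : A.W) : P.1.1 * Q.1.1 = 0 → val A P = ⊤ → val A Q < ⊤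

end Valuations

end QuantumTopos

open QuantumTopos CategoryTheory Opposite

/-! ### Subpresheaves and their characteristic morphisms, over an arbitrary small-presheaf base `C`.
-/

namespace CategoryTheory

open Opposite

universe v u

variable {C : Type u} [Category.{v} C] {G : Cᵒᵖ ⥤ Type (max u v)}

/-! Naturality of `N^ν` is the functional composition condition, once two features of `𝒪` are taken
into account: every morphism `B ⟶ A` arises from some Borel function `h` with `B = h(A)`, and
parallel morphisms are equal, so it does not matter which `h` is chosen. The map `G(h_𝒪)` is
coarse-graining to `h(A)`, the map `Ω(h_𝒪)` is the pull-back of sieves, and the condition says that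
the square formed with `ν_A` and `ν_{h(A)}` commutes (`GeneralizedValuation.val_coarseGrain`).

The rest is the subobject classifier of a presheaf category, and holds for any `N : G ⟶ Ω`. The
characteristic morphism of a subpresheaf `K` sends `x` to the sieve of those `f` along which `x`
restricts into `K`. A sieve is maximal iff it contains the identity, so `K` is recovered as the set
of elements sent to the maximal sieve; this gives uniqueness. Conversely, `f` lies in the sieve
`N(x)` iff `f^*(N(x))` is maximal, and by naturality that pull-back is `N` of the restriction of `x`
along `f`. Hence `N` is the characteristic morphism of the preimage of the maximal sieves; this
gives existence. `Presheaf.χ_ι_eq_iff` combines the two. -/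

/-- The subpresheaf of `G` classified by `N : G ⟶ Ω`: the elements that `N` sends to the maximal
sieve. -/
def Subfunctor.classifiedBy (N : G ⟶ Functor.sieves C) : Subfunctor G where
  obj X := {x | N.app X x = (⊤ : Sieve X.unop)}
  map {X Y} f x hx := by
    change N.app Y (G.map f x) = (⊤ : Sieve Y.unop)
    -- Closure under restriction: by naturality the sieve of a restricted element is a pull-back of
    -- the maximal sieve, which is again maximal.
    rw [NatTrans.naturality_apply N f x, show N.app X x = (⊤ : Sieve X.unop) from hx]
    exact Sieve.pullback_top

/-- For a general mono the characteristic sieve asks for a preimage of the restricted element. For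
the inclusion of a subpresheaf such a preimage is the element itself with its proof of membership.
-/
theorem Presheaf.χ_ι_apply (K : Subfunctor G) (X : Cᵒᵖ) (x : G.obj X) {Y : C} (f : Y ⟶ X.unop) :
    Sieve.arrows (X := X.unop) ((Presheaf.χ K.ι).app X x) f ↔ G.map f.op x ∈ K.obj (op Y) :=
  ⟨fun ⟨a, ha⟩ => ha ▸ a.2, fun h => ⟨⟨_, h⟩, rfl⟩⟩

/-- A sieve is maximal iff it contains the identity, and restriction along the identity fixes `x`.
So the characteristic morphism determines `K`. -/
theorem Presheaf.χ_ι_eq_top_iff (K : Subfunctor G) (X : Cᵒᵖ) (x : G.obj X) :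
    (Presheaf.χ K.ι).app X x = (⊤ : Sieve X.unop) ↔ x ∈ K.obj X := by
  refine (Sieve.id_mem_iff_eq_top (S := ((Presheaf.χ K.ι).app X x : Sieve X.unop))).symm.trans ?_
  refine (Presheaf.χ_ι_apply K X x (𝟙 _)).trans ?_
  rw [op_id, Functor.map_id_apply]

/-- A subpresheaf of `G` has characteristic morphism `N` iff it is the one classified by `N`. -/
theorem Presheaf.χ_ι_eq_iff (K : Subfunctor G) (N : G ⟶ Functor.sieves C) :
    Presheaf.χ K.ι = N ↔ K = Subfunctor.classifiedBy N := by
  constructor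
  -- Uniqueness: `K` is read off from its own characteristic morphism.
  · rintro rfl
    ext X x
    exact (Presheaf.χ_ι_eq_top_iff K X x).symm
  -- Existence: the two morphisms are compared sieve by sieve, one arrow `f` at a time.
  · rintro rfl
    ext X x
    refine Sieve.ext fun Y f => ?_
    refine (Presheaf.χ_ι_apply _ X x f).trans ?_
    change N.app (op Y) (G.map f.op x) = (⊤ : Sieve Y) ↔ _
    rw [NatTrans.naturality_apply N f.op x]
    -- Naturality has turned the left side into maximality of `f^*(N(x))`, which is equivalent to
    -- `f` belonging to `N(x)`.
    exact (Sieve.mem_iff_pullback_eq_top (S := (N.app X x : Sieve X.unop)) f).symm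

end CategoryTheory

/-! ### Generalized valuations as natural transformations to `Ω`. -/

namespace QuantumTopos

open CategoryTheory Opposite

universe u

variable {H : Type u} [NormedAddCommGroup H] [InnerProductSpace ℂ H] [CompleteSpace H]
  [TopologicalSpace.SeparableSpace H]

/-- Functional composition along an arbitrary morphism of `𝒪`. -/
theorem GeneralizedValuation.val_coarseGrain (ν : GeneralizedValuation H) {A B : SelfAdjointOp H}
    (f : B ⟶ A) (P : A.W) : ν.val B (B.coarseGrain P) = (ν.val A P).pullback f := by
  -- After the substitution `f` and `h.hom` are parallel arrows of a preorder category, hence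
  -- definitionally equal, so the axiom for `h` applies to `f` unchanged.
  obtain ⟨h, rfl⟩ := leOfHom f
  exact ν.functional_composition A h P

/-- The natural transformation `N^ν : G ⟶ Ω` with components `ν_A`. -/
noncomputable def GeneralizedValuation.natTrans (ν : GeneralizedValuation H) :
    coarseGrainingPresheaf H ⟶ Functor.sieves (SelfAdjointOp H) where
  app A := ↾fun P => ν.val A.unop P
  naturality {_ _} f := by
    ext P : 3
    exact ν.val_coarseGrain f.unop P

end QuantumTopos

open QuantumTopos CategoryTheory Opposite
-- The final equivalence carries both halves of "one and only": `K' = K` shows that `K` has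
-- characteristic morphism `N`, and the forward direction that no other subpresheaf does.
theorem mainTheorem4 {H : Type*} [NormedAddCommGroup H] [InnerProductSpace ℂ H] [CompleteSpace H]
    [TopologicalSpace.SeparableSpace H] (ν : GeneralizedValuation H) :
    ∃ N : coarseGrainingPresheaf H ⟶ Functor.sieves (SelfAdjointOp H),
      (∀ (A : SelfAdjointOp H) (P : A.W), N.app (op A) P = ν.val A P) ∧
      ∃ K : Subfunctor (coarseGrainingPresheaf H),
        (∀ A : SelfAdjointOp H, K.obj (op A) = {P : A.W | ν.val A P = ⊤}) ∧
        ∀ K' : Subfunctor (coarseGrainingPresheaf H),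
          (Presheaf.classifier (SelfAdjointOp H)).χ K'.ι = N ↔ K' = K :=
  -- The components of `N` and the sets `K(A)` are as required by definition, and the `χ` of
  -- `Presheaf.classifier` unfolds to `Presheaf.χ`.
  ⟨ν.natTrans, fun _ _ => rfl, Subfunctor.classifiedBy ν.natTrans, fun _ => rfl,
    fun K' => Presheaf.χ_ι_eq_iff K' ν.natTrans⟩
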